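/- Let $(R,\mathfrak m)$ be a (Noetherian) Cohen–Macaulay local ring of dimension one possessing a canonical module $\omega_R$. Let $Q(R)$ be its total ring of fractions and $\overline R$ the integral closure of $R$ in $Q(R)$. Suppose that (a) there is an $R$-submodule $C$ of $Q(R)$ with $R\subseteq C\subseteq\overline R$ and $C\cong\omega_R$; (b) $\overline R$ is finitely generated as an $R$-module; (c) $\overline R$ is a local ring; (d) there is a non-zerodivisor $a\in\mathfrak m$ such that $(a)$ is a reduction of $\mathfrak m$, i.e. $\mathfrak m^{n+1}=a\,\mathfrak m^{n}$ for some $n\ge 0$. Suppose further that $R$ is far-flung Gorenstein, that is, $\operatorname{tr}_R(\omega_R)=R:\overline R$, where $\operatorname{tr}_R(\omega_R)=\sum_{f\in\operatorname{Hom}_R(\omega_R,R)}\operatorname{Im} f$ and $R:\overline R=\{\alpha\in Q(R)\mid \alpha\overline R\subseteq R\}$. Let $r(R)=\dim_{R/\mathfrak m}\operatorname{Ext}^1_R(R/\mathfrak m,R)$ be the Cohen–Macaulay type and $e(R)=\lim_{n\to\infty}\ell_R(R/\mathfrak m^n)/n$ the multiplicity of $R$. Then $$e(R)\le\binom{r(R)+1}{2},$$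 and if $R$ is not a discrete valuation ring, then moreover $$r(R)+1\le e(R).$$ -/

import Mathlib

open CategoryTheory Filter Topology IsLocalRing

universe u

/-- `M` is a maximal Cohen-Macaulay module over the Noetherian local ring `R` of Krull dimension
`d`: it is finitely generated and the maximal ideal contains an `M`-regular sequence of length `d`
(`IsRegular` includes `(x₁, …, x_d) M ≠ M`, in particular `M ≠ 0`). -/
structure IsMaximalCohenMacaulay (R : Type u) [CommRing R] [IsLocalRing R] (d : ℕ)
    (M : Type u) [AddCommGroup M] [Module R M] : Prop where
  finite : Module.Finite R M
  exists_isRegular : ∃ rs : List R, rs.length = d ∧ (∀ x ∈ rs, x ∈ maximalIdeal R) ∧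
    RingTheory.Sequence.IsRegular M rs

/-- `R` is a (Noetherian) Cohen-Macaulay local ring of Krull dimension `d`. -/
structure IsCohenMacaulayLocalRing (R : Type u) [CommRing R] [IsLocalRing R] (d : ℕ) :
    Prop where
  isNoetherianRing : IsNoetherianRing R
  ringKrullDim_eq : ringKrullDim R = d
  maximalCohenMacaulay : IsMaximalCohenMacaulay R d R

/-- The Cohen-Macaulay type of a module `M` of depth `d` over the local ring `(R, 𝔪, k)`: the
`k`-dimension of `Ext_R^d(k, M)`. As `𝔪` annihilates this module, the dimension is its length
over `R`. -/
noncomputable def cohenMacaulayType (R : Type u) [CommRing R] [IsLocalRing R] (d : ℕ)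
    (M : Type u) [AddCommGroup M] [Module R M] : ℕ∞ :=
  Module.length R (Abelian.Ext (ModuleCat.of R (ResidueField R)) (ModuleCat.of R M) d)

/-- `ω` is a canonical module of the Cohen-Macaulay local ring `R` of dimension `d`: a maximal
Cohen-Macaulay module of type one and of finite injective dimension. -/
structure IsCanonicalModule (R : Type u) [CommRing R] [IsLocalRing R] (d : ℕ)
    (ω : Type u) [AddCommGroup ω] [Module R ω] : Prop where
  maximalCohenMacaulay : IsMaximalCohenMacaulay R d ω
  type_eq_one : cohenMacaulayType R d ω = 1
  finite_injectiveDimension : ∃ n : ℕ, HasInjectiveDimensionLE (ModuleCat.of R ω) n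

/-- The natural number `e` is the (Hilbert-Samuel) multiplicity of the Noetherian local ring
`(R, 𝔪)` of dimension `d`: `e = lim d! · ℓ_R(R / 𝔪 ^ n) / n ^ d`. -/
def HasMultiplicity (R : Type u) [CommRing R] [IsLocalRing R] (d e : ℕ) : Prop :=
  Tendsto (fun n : ℕ => ((d.factorial : ℝ) *
      ((Module.length R (R ⧸ maximalIdeal R ^ n)).toNat : ℝ)) / (n : ℝ) ^ d)
    atTop (𝓝 (e : ℝ))

/-- The ideal `J` is a reduction of the ideal `I`. -/
def IsReductionOf {R : Type u} [CommRing R] (J I : Ideal R) : Prop :=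
  J ≤ I ∧ ∃ n : ℕ, I ^ (n + 1) = J * I ^ n

/-- The trace ideal of `M`: the sum of the images of all `R`-linear maps `M → R`. -/
def traceIdeal (R : Type u) [CommRing R] (M : Type u) [AddCommGroup M] [Module R M] : Ideal R :=
  ⨆ f : M →ₗ[R] R, LinearMap.range f

/-- The integral closure `R̄` of `R` in its total ring of fractions `Q(R)`. -/
abbrev normalClosureRing (R : Type u) [CommRing R] : Subalgebra R (FractionRing R) :=
  integralClosure R (FractionRing R)

/-- The far-flung Gorenstein property `tr_R(ω) = R : R̄`, an equality of `R`-submodules of `Q(R)`;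
here `R : R̄` is the set of all `α` in `Q(R)` with `α R̄ ⊆ R`. -/
def IsFarFlungGorenstein (R : Type u) [CommRing R]
    (ω : Type u) [AddCommGroup ω] [Module R ω] : Prop :=
  IsLocalization.coeSubmodule (FractionRing R) (traceIdeal R ω) =
    (1 : Submodule R (FractionRing R)) / Subalgebra.toSubmodule (normalClosureRing R)

/-! Write `B` for the integral closure and `X : Y` for quotients in `Q(R)`. Since `C` has type one,
`ℓ((C : 𝔪) / C) = 1`, and this alone makes `X ↦ C : X` a length-preserving duality on regular
fractional ideals (`IsRegularFractional.relLength_div_eq`, `IsRegularFractional.div_div_eq`). In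
particular `C : C = R`.

Upper bound: `C : C² = R : C ⊆ tr ω = R : B = C : B`, so dualizing gives `B ⊆ C²`, hence `C² = B`
(`IsFarFlungGorenstein.mul_self_eq`). By duality `ℓ(C / 𝔪C) = ℓ((R : 𝔪) / R) = r`, so `r` elements
generate `C` and their `(r + 1).choose 2` products generate `B`. As `(a)` is a reduction of `𝔪`, `𝔪B
⊆ aB`, and `e = ℓ(R / aR) = ℓ(B / aB) ≤ ℓ(B / 𝔪B)`.

Lower bound: `R ⊆ R : 𝔪 ⊆ a⁻¹R` with `ℓ(a⁻¹R / R) = e`, and the last inclusion is strict unless `𝔪 =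
(a)`. -/

open scoped nonZeroDivisors Pointwise

/-! ### Relative lengths of submodules. -/

section RelLength

variable {R V W : Type*} [CommRing R] [AddCommGroup V] [Module R V] [AddCommGroup W] [Module R W]

/-- The length of `X / (X ∩ Y)`, for submodules `X` and `Y` of a common module. -/
noncomputable def relLength (Y X : Submodule R V) : ℕ∞ :=
  Module.length R (X ⧸ Y.submoduleOf X)

theorem Submodule.mem_submoduleOf {Y X : Submodule R V} {x : X} :
    x ∈ Y.submoduleOf X ↔ (x : V) ∈ Y := Iff.rfl

theorem relLength_eq_length_of_surjective {Y X : Submodule R V} (f : X →ₗ[R] W)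
    (hf : Function.Surjective f) (hker : ∀ x : X, f x = 0 ↔ (x : V) ∈ Y) :
    relLength Y X = Module.length R W := by
  have h : Y.submoduleOf X = LinearMap.ker f := by
    ext x
    rw [LinearMap.mem_ker, hker, Submodule.mem_submoduleOf]
  rw [relLength, h]
  exact (f.quotKerEquivOfSurjective hf).length_eq

theorem relLength_le_length {Y X : Submodule R V} (f : X →ₗ[R] W)
    (hker : ∀ x : X, f x = 0 → (x : V) ∈ Y) (hY : ∀ x : X, (x : V) ∈ Y → f x = 0) :
    relLength Y X ≤ Module.length R W := by
  rw [relLength_eq_length_of_surjective f.rangeRestrict f.surjective_rangeRestrict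
    (fun x => by
      rw [← Subtype.coe_inj]
      exact ⟨hker x, hY x⟩)]
  exact Module.length_le_of_injective _ (LinearMap.range f).injective_subtype

theorem relLength_le_relLength_of_map {Y X : Submodule R V} {Y' X' : Submodule R W}
    (f : X →ₗ[R] W) (hX : ∀ x, f x ∈ X') (hY : ∀ x, f x ∈ Y' ↔ (x : V) ∈ Y) :
    relLength Y X ≤ relLength Y' X' := by
  refine relLength_le_length ((Y'.submoduleOf X').mkQ ∘ₗ f.codRestrict X' hX) ?_ ?_ <;>
  · intro x
    simp [Submodule.mem_submoduleOf, hY]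

theorem relLength_map_of_injective (f : V →ₗ[R] W) (hf : Function.Injective f)
    (Y X : Submodule R V) : relLength (Y.map f) (X.map f) = relLength Y X := by
  symm
  refine relLength_eq_length_of_surjective
    (((Y.map f).submoduleOf (X.map f)).mkQ ∘ₗ
      f.restrict (p := X) (q := X.map f) fun x hx => Submodule.mem_map_of_mem hx) ?_ ?_
  · refine (Submodule.mkQ_surjective _).comp ?_
    rintro ⟨_, x, hx, rfl⟩
    exact ⟨⟨x, hx⟩, rfl⟩
  · intro x
    simp [Submodule.mem_submoduleOf, hf.eq_iff]

theorem relLength_add {Z Y X : Submodule R V} (hZY : Z ≤ Y) (hYX : Y ≤ X) :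
    relLength Z X = relLength Z Y + relLength Y X := by
  have hle : Z.submoduleOf Y ≤ (Z.submoduleOf X).comap (Submodule.inclusion hYX) :=
    fun x hx => hx
  refine Module.length_eq_add_of_exact
    (Submodule.mapQ (Z.submoduleOf Y) (Z.submoduleOf X) (Submodule.inclusion hYX) hle)
    (Submodule.factor (p := Z.submoduleOf X) (p' := Y.submoduleOf X) fun _ hx => hZY hx) ?_
    (Submodule.factor_surjective _) ?_
  · rw [← LinearMap.ker_eq_bot, LinearMap.ker_eq_bot']
    intro q
    obtain ⟨x, rfl⟩ := Submodule.mkQ_surjective _ q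
    intro hx
    simpa [Submodule.mem_submoduleOf] using hx
  · intro q
    obtain ⟨x, rfl⟩ := Submodule.mkQ_surjective _ q
    constructor
    · intro hx
      have hx' : (x : V) ∈ Y := (Submodule.Quotient.mk_eq_zero (Y.submoduleOf X)).mp hx
      exact ⟨Submodule.Quotient.mk ⟨x, hx'⟩, rfl⟩
    · rintro ⟨p, hp⟩
      obtain ⟨y, rfl⟩ := Submodule.mkQ_surjective _ p
      rw [← hp]
      exact (Submodule.Quotient.mk_eq_zero (Y.submoduleOf X)).mpr y.2

theorem relLength_eq_zero_iff {Y X : Submodule R V} : relLength Y X = 0 ↔ X ≤ Y := by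
  rw [relLength, Module.length_eq_zero_iff, Submodule.Quotient.subsingleton_iff,
    Submodule.submoduleOf_eq_top]

theorem relLength_le_of_le {Z Y X : Submodule R V} (hZY : Z ≤ Y) :
    relLength Y X ≤ relLength Z X :=
  Module.length_le_of_surjective (Submodule.factor (p := Z.submoduleOf X) (p' := Y.submoduleOf X)
    fun _ hx => hZY hx) (Submodule.factor_surjective _)

theorem relLength_top (I : Submodule R V) : relLength I ⊤ = Module.length R (V ⧸ I) :=
  relLength_eq_length_of_surjective (I.mkQ ∘ₗ (⊤ : Submodule R V).subtype)
    ((Submodule.mkQ_surjective _).comp fun x => ⟨⟨x, trivial⟩, rfl⟩) (by simp)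

/-- A proper inclusion with quotient of finite length factors through a submodule that is
generated over the smaller one by a socle element. -/
theorem exists_socle_element [IsLocalRing R] {Y X : Submodule R V} (hne : ¬ X ≤ Y)
    (hfin : relLength Y X ≠ ⊤) :
    ∃ x ∈ X, x ∉ Y ∧ ∀ r ∈ maximalIdeal R, r • x ∈ Y := by
  rw [relLength, Module.length_ne_top_iff, isFiniteLength_iff_isNoetherian_isArtinian] at hfin
  obtain ⟨-, hart⟩ := hfin
  have hnt : Nontrivial (X ⧸ Y.submoduleOf X) := by
    rw [Submodule.Quotient.nontrivial_iff]
    rwa [Ne, Submodule.submoduleOf_eq_top]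
  obtain h | ⟨S, hS, -⟩ := IsAtomic.eq_bot_or_exists_atom_le (⊤ : Submodule R (X ⧸ Y.submoduleOf X))
  · exact absurd h top_ne_bot
  have hsimple : IsSimpleModule R S := isSimpleModule_iff_isAtom.mpr hS
  have hSnt : Nontrivial S := IsSimpleModule.nontrivial R S
  obtain ⟨⟨s, hs⟩, hs0⟩ := exists_ne (0 : S)
  obtain ⟨x, rfl⟩ := Submodule.mkQ_surjective _ s
  refine ⟨x, x.2, fun hx => hs0 ?_, fun r hr => ?_⟩
  · ext
    simpa [Submodule.mem_submoduleOf] using hx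
  · have hann : Module.annihilator R S = maximalIdeal R :=
      eq_maximalIdeal (IsSimpleModule.annihilator_isMaximal (R := R) (M := S))
    rw [← hann, Module.mem_annihilator] at hr
    have := congrArg Subtype.val (hr ⟨_, hs⟩)
    rw [Submodule.coe_smul, ← map_smul] at this
    exact (Submodule.Quotient.mk_eq_zero (Y.submoduleOf X)).mp this

/-- A socle element of `X / Y` lowers the length by at least one when adjoined to `Y`. This drives
the inductions on length, both for duality and for counting generators. -/
theorem exists_relLength_sup_span_le [IsLocalRing R] {Y X : Submodule R V} (hYX : Y ≤ X)
    (hne : ¬ X ≤ Y) {n : ℕ} (hn : relLength Y X ≤ (n + 1 : ℕ)) :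
    ∃ x ∈ X, (∀ r ∈ maximalIdeal R, r • x ∈ Y) ∧ Y ⊔ Submodule.span R {x} ≤ X ∧
      relLength (Y ⊔ Submodule.span R {x}) X ≤ n := by
  obtain ⟨x, hxX, hxY, hx⟩ :=
    exists_socle_element hne (ne_top_of_le_ne_top (ENat.natCast_ne_top _) hn)
  have hxZ : x ∈ Y ⊔ Submodule.span R {x} :=
    Submodule.mem_sup_right (Submodule.mem_span_singleton_self x)
  have hZX : Y ⊔ Submodule.span R {x} ≤ X :=
    sup_le hYX ((Submodule.span_singleton_le_iff_mem _ _).mpr hxX)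
  refine ⟨x, hxX, hx, hZX, ?_⟩
  have hpos : 1 ≤ relLength Y (Y ⊔ Submodule.span R {x}) :=
    Order.one_le_iff_ne_zero.mpr fun h0 => hxY (relLength_eq_zero_iff.mp h0 hxZ)
  rw [relLength_add le_sup_left hZX, Nat.cast_add, Nat.cast_one, add_comm] at hn
  exact (ENat.add_le_add_iff_right ENat.one_ne_top).mp ((add_le_add_right hpos _).trans hn)

end RelLength

/-! ### Regular fractional ideals in the total ring of fractions. -/

section Lattice

variable {R Q : Type*} [CommRing R] [CommRing Q] [Algebra R Q]

theorem mem_units_smul_iff {u : Qˣ} {X : Submodule R Q} {x : Q} :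
    x ∈ u • X ↔ (↑u⁻¹ : Q) * x ∈ X := by
  constructor
  · intro h
    obtain ⟨y, hy, rfl⟩ := (Submodule.mem_smul_pointwise_iff_exists _ _ _).mp h
    rw [Units.smul_def, smul_eq_mul, Units.inv_mul_cancel_left]
    exact hy
  · intro h
    have := Submodule.smul_mem_pointwise_smul _ u X h
    rwa [Units.smul_def, smul_eq_mul, Units.mul_inv_cancel_left] at this

theorem mul_mem_units_smul {u : Qˣ} {X : Submodule R Q} {x : Q} (hx : x ∈ X) :
    (u : Q) * x ∈ u • X :=
  Submodule.smul_mem_pointwise_smul x u X hx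

theorem relLength_units_smul (u : Qˣ) (Y X : Submodule R Q) :
    relLength (u • Y) (u • X) = relLength Y X :=
  relLength_map_of_injective (DistribSMul.toLinearMap R Q u)
    (MulAction.injective u) Y X

theorem div_units_smul (u : Qˣ) (C X : Submodule R Q) : C / (u • X) = u⁻¹ • (C / X) := by
  ext z
  rw [mem_units_smul_iff, inv_inv, Submodule.mem_div_iff_forall_mul_mem,
    Submodule.mem_div_iff_forall_mul_mem]
  constructor
  · intro h y hy
    have := h _ (mul_mem_units_smul (u := u) hy)
    rwa [← mul_assoc, mul_comm z] at this
  · intro h y hy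
    have := h _ (mem_units_smul_iff.mp hy)
    rwa [mul_comm (u : Q), mul_assoc, Units.mul_inv_cancel_left] at this

theorem Submodule.div_le_div_left {Y X : Submodule R Q} (C : Submodule R Q) (h : Y ≤ X) :
    C / X ≤ C / Y := fun _ hz => Submodule.mem_div_iff_forall_mul_mem.mpr fun y hy =>
  Submodule.mem_div_iff_forall_mul_mem.mp hz y (h hy)

theorem Submodule.div_div (C X Y : Submodule R Q) : C / X / Y = C / (X * Y) :=
  eq_of_forall_le_iff fun Z => by
    rw [Submodule.le_div_iff_mul_le, Submodule.le_div_iff_mul_le, Submodule.le_div_iff_mul_le,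
      mul_comm X, mul_assoc]

theorem Submodule.le_div_div (C X : Submodule R Q) : X ≤ C / (C / X) := by
  rw [Submodule.le_div_iff_mul_le, mul_comm, ← Submodule.le_div_iff_mul_le]

theorem one_eq_coeSubmodule_top : (1 : Submodule R Q) = IsLocalization.coeSubmodule Q (⊤ : Ideal R) := by
  rw [IsLocalization.coeSubmodule_top]

/-- `X` is a fractional ideal of the total ring of fractions `Q` of `R` that contains a
non-zerodivisor. -/
structure IsRegularFractional (X : Submodule R Q) : Prop where
  exists_mul_mem_one : ∃ t : R⁰, ∀ x ∈ X, algebraMap R Q t * x ∈ (1 : Submodule R Q)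
  exists_mem : ∃ s : R⁰, algebraMap R Q s ∈ X

namespace IsRegularFractional

variable {X Y C : Submodule R Q}

theorem of_le (hX : IsRegularFractional X) (hYX : Y ≤ X) (hY : ∃ s : R⁰, algebraMap R Q s ∈ Y) :
    IsRegularFractional Y :=
  ⟨hX.exists_mul_mem_one.imp fun _ ht x hx => ht x (hYX hx), hY⟩

theorem one : IsRegularFractional (1 : Submodule R Q) :=
  ⟨⟨1, by simp⟩, ⟨1, Submodule.mem_one.mpr ⟨1, rfl⟩⟩⟩

theorem mul (hX : IsRegularFractional X) (hY : IsRegularFractional Y) :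
    IsRegularFractional (X * Y) := by
  obtain ⟨⟨t, ht⟩, s, hs⟩ := hX
  obtain ⟨⟨t', ht'⟩, s', hs'⟩ := hY
  refine ⟨⟨t * t', fun x hx => ?_⟩, s * s', by simpa using Submodule.mul_mem_mul hs hs'⟩
  refine Submodule.mul_induction_on hx (fun x hx y hy => ?_) fun x y hx hy => ?_
  · have := Submodule.mul_mem_mul (ht x hx) (ht' y hy)
    rw [one_mul, mul_mul_mul_comm] at this
    simpa using this
  · rw [mul_add]
    exact add_mem hx hy

/-- A denominator `t` of `C` and some `s' ∈ X` give the denominator `t * s'`, because `z * s' ∈ C`.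
A denominator `t'` of `X` and some `s ∈ C` give the element `t' * s` of `C : X`. -/
theorem div (hC : IsRegularFractional C) (hX : IsRegularFractional X) :
    IsRegularFractional (C / X) := by
  obtain ⟨⟨t, ht⟩, s, hs⟩ := hC
  obtain ⟨⟨t', ht'⟩, s', hs'⟩ := hX
  refine ⟨⟨t * s', fun z hz => ?_⟩, t' * s, ?_⟩
  · have := ht _ (Submodule.mem_div_iff_forall_mul_mem.mp hz _ hs')
    rw [Submonoid.coe_mul, map_mul, mul_assoc, mul_comm (algebraMap R Q s')]
    exact this
  · rw [Submodule.mem_div_iff_forall_mul_mem]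
    intro y hy
    obtain ⟨r, hr⟩ := Submodule.mem_one.mp (ht' y hy)
    rw [Submonoid.coe_mul, map_mul, mul_right_comm, ← hr, ← Algebra.smul_def]
    exact C.smul_mem _ hs

end IsRegularFractional

variable [IsFractionRing R Q]

/-- The unit of the total ring of fractions given by a non-zerodivisor. -/
noncomputable def nonZeroDivisorsUnit (Q : Type*) [CommRing Q] [Algebra R Q] [IsFractionRing R Q]
    (t : R⁰) : Qˣ :=
  (IsLocalization.map_units Q t).unit

@[simp] theorem coe_nonZeroDivisorsUnit (t : R⁰) :
    (nonZeroDivisorsUnit Q t : Q) = algebraMap R Q t := rfl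

theorem mem_nonZeroDivisorsUnit_smul_iff {t : R⁰} {X : Submodule R Q} {x : Q} :
    x ∈ nonZeroDivisorsUnit Q t • X ↔ ∃ y ∈ X, (t : R) • y = x := by
  refine (Submodule.mem_smul_pointwise_iff_exists _ _ _).trans ?_
  simp [Units.smul_def, Algebra.smul_def]

theorem nonZeroDivisorsUnit_smul_le (t : R⁰) (X : Submodule R Q) :
    nonZeroDivisorsUnit Q t • X ≤ X := fun _ hx => by
  obtain ⟨y, hy, rfl⟩ := mem_nonZeroDivisorsUnit_smul_iff.mp hx
  exact X.smul_mem _ hy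

theorem exists_mul_mem_one_of_fg {X : Submodule R Q} (hX : X.FG) :
    ∃ t : R⁰, ∀ x ∈ X, algebraMap R Q t * x ∈ (1 : Submodule R Q) := by
  obtain ⟨a, ha, h⟩ := FractionalIdeal.isFractional_of_fg (S := R⁰) hX
  refine ⟨⟨a, ha⟩, fun x hx => ?_⟩
  obtain ⟨r, hr⟩ := h x hx
  rw [Submodule.mem_one]
  exact ⟨r, by rw [hr, Algebra.smul_def]⟩

namespace IsRegularFractional

variable {X Y C : Submodule R Q}

theorem smul (hX : IsRegularFractional X) (t : R⁰) :
    IsRegularFractional (nonZeroDivisorsUnit Q t • X) := by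
  obtain ⟨s, hs⟩ := hX.exists_mem
  refine hX.of_le (nonZeroDivisorsUnit_smul_le t X) ⟨t * s, ?_⟩
  simpa using mul_mem_units_smul (u := nonZeroDivisorsUnit Q t) hs

/-- Regular fractional ideals are commensurable. -/
theorem exists_smul_le (hX : IsRegularFractional X) (hY : IsRegularFractional Y) :
    ∃ t : R⁰, nonZeroDivisorsUnit Q t • X ≤ Y := by
  obtain ⟨t, ht⟩ := (hY.div hX).exists_mem
  refine ⟨t, fun x hx => ?_⟩
  obtain ⟨y, hy, rfl⟩ := mem_nonZeroDivisorsUnit_smul_iff.mp hx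
  rw [Algebra.smul_def]
  exact Submodule.mem_div_iff_forall_mul_mem.mp ht y hy

end IsRegularFractional

theorem relLength_coeSubmodule (I J : Ideal R) :
    relLength (IsLocalization.coeSubmodule Q I) (IsLocalization.coeSubmodule Q J) =
      relLength I J :=
  relLength_map_of_injective (Algebra.linearMap R Q) (IsFractionRing.injective R Q) I J

theorem nonZeroDivisorsUnit_smul_coeSubmodule (t : R⁰) (I : Ideal R) :
    nonZeroDivisorsUnit Q t • IsLocalization.coeSubmodule Q I =
      IsLocalization.coeSubmodule Q (Ideal.span {(t : R)} * I) := by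
  ext x
  rw [mem_nonZeroDivisorsUnit_smul_iff, IsLocalization.mem_coeSubmodule]
  simp only [IsLocalization.mem_coeSubmodule, Ideal.mem_span_singleton_mul]
  constructor
  · rintro ⟨_, ⟨y, hy, rfl⟩, rfl⟩
    exact ⟨_, ⟨y, hy, rfl⟩, by rw [Algebra.smul_def, map_mul]⟩
  · rintro ⟨_, ⟨y, hy, rfl⟩, rfl⟩
    exact ⟨_, ⟨y, hy, rfl⟩, by rw [Algebra.smul_def, map_mul]⟩

theorem relLength_nonZeroDivisorsUnit_smul_one (t : R⁰) :
    relLength (nonZeroDivisorsUnit Q t • (1 : Submodule R Q)) 1 =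
      Module.length R (R ⧸ Ideal.span {(t : R)}) := by
  rw [one_eq_coeSubmodule_top, nonZeroDivisorsUnit_smul_coeSubmodule, relLength_coeSubmodule, Ideal.mul_top,
    relLength_top]

theorem length_quotient_span_singleton_ne_top [IsNoetherianRing R] (hdim : ringKrullDim R ≤ 1)
    (t : R⁰) : Module.length R (R ⧸ Ideal.span {(t : R)}) ≠ ⊤ := by
  have h : ringKrullDim (R ⧸ Ideal.span {(t : R)}) ≤ 0 := by
    have h1 := (ringKrullDim_quotient_succ_le_of_nonZeroDivisor t.2).trans hdim
    rw [← zero_add (1 : WithBot ℕ∞)] at h1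
    exact (ENat.WithBot.add_le_add_one_right_iff).mp h1
  have : Ring.KrullDimLE 0 (R ⧸ Ideal.span {(t : R)}) :=
    (Order.krullDimLE_iff _ _).mpr h
  have : IsArtinianRing (R ⧸ Ideal.span {(t : R)}) := isArtinianRing_iff_krullDimLE_zero.mpr this
  have : IsArtinian R (R ⧸ Ideal.span {(t : R)}) :=
    isArtinian_of_surjective_algebraMap (R := R ⧸ Ideal.span {(t : R)}) Ideal.Quotient.mk_surjective
  exact Module.length_ne_top

variable [IsNoetherianRing R]

theorem IsRegularFractional.relLength_one_ne_top (hdim : ringKrullDim R ≤ 1)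
    {X : Submodule R Q} (hX : IsRegularFractional X) :
    relLength X 1 ≠ ⊤ := by
  obtain ⟨s, hs⟩ := IsRegularFractional.one.exists_smul_le hX
  refine ne_top_of_le_ne_top (length_quotient_span_singleton_ne_top hdim s) ?_
  rw [← relLength_nonZeroDivisorsUnit_smul_one (Q := Q)]
  exact relLength_le_of_le hs

/-- The length of `X / tX` is the same for all regular fractional ideals `X`. -/
theorem IsRegularFractional.relLength_smul_self (hdim : ringKrullDim R ≤ 1)
    {X : Submodule R Q} (hX : IsRegularFractional X)
    (t : R⁰) :
    relLength (nonZeroDivisorsUnit Q t • X) X = Module.length R (R ⧸ Ideal.span {(t : R)}) := by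
  -- Rescaling `X` by a non-zerodivisor does not change the length of `X / tX`.
  wlog h : X ≤ 1 generalizing X
  · obtain ⟨s, hs⟩ := hX.exists_smul_le .one
    rw [← this (hX.smul s) hs, smul_comm, relLength_units_smul]
  -- Measure `R / tX` through `X` and through `tR`, then cancel the finite length `ℓ(tR / tX) = ℓ(R
  -- / X)`.
  · have hsmul : nonZeroDivisorsUnit Q t • X ≤ nonZeroDivisorsUnit Q t • 1 :=
      Submodule.map_mono h
    have h1 := relLength_add (nonZeroDivisorsUnit_smul_le t X) h
    rw [relLength_add hsmul (nonZeroDivisorsUnit_smul_le t 1), relLength_units_smul, add_comm,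
      relLength_nonZeroDivisorsUnit_smul_one] at h1
    exact ((WithTop.add_right_inj (IsRegularFractional.relLength_one_ne_top hdim hX)).mp h1).symm

end Lattice

/-! ### Duality with respect to a fractional ideal of type at most one. -/

section Duality

variable {R Q : Type*} [CommRing R] [CommRing Q] [Algebra R Q] [IsLocalRing R]

/-- Dualizing into a fractional ideal of type at most one does not increase lengths. -/
theorem relLength_div_le_of_le_natCast {C : Submodule R Q}
    (hC : relLength C (C / IsLocalization.coeSubmodule Q (maximalIdeal R)) ≤ 1) (n : ℕ)
    {Y X : Submodule R Q} (hYX : Y ≤ X) (hn : relLength Y X ≤ n) :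
    relLength (C / X) (C / Y) ≤ n := by
  induction n generalizing Y with
  | zero =>
    have h : X ≤ Y := relLength_eq_zero_iff.mp (by simpa using hn)
    rw [relLength_eq_zero_iff.mpr (Submodule.div_le_div_left C h)]
    exact zero_le
  | succ n ih =>
    by_cases h : X ≤ Y
    · rw [relLength_eq_zero_iff.mpr (Submodule.div_le_div_left C h)]
      exact zero_le
    obtain ⟨x, -, hx, hZX, hZ⟩ := exists_relLength_sup_span_le hYX h hn
    have hYZ : Y ≤ Y ⊔ Submodule.span R {x} := le_sup_left
    have hxZ : x ∈ Y ⊔ Submodule.span R {x} :=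
      Submodule.mem_sup_right (Submodule.mem_span_singleton_self x)
    have hstep : relLength (C / (Y ⊔ Submodule.span R {x})) (C / Y) ≤ 1 := by
      -- Since `𝔪x ⊆ Y`, the map `z ↦ z * x` sends `C : Y` into `C : 𝔪`, and `z * x ∈ C` exactly
      -- when `z ∈ C : (Y + Rx)`.
      refine (relLength_le_relLength_of_map
        (LinearMap.mulRight R x ∘ₗ (C / Y).subtype) ?_ ?_).trans hC
      · rintro ⟨z, hz⟩
        rw [Submodule.mem_div_iff_forall_mul_mem]
        rintro _ ⟨r, hr, rfl⟩
        have := Submodule.mem_div_iff_forall_mul_mem.mp hz _ (hx r hr)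
        rw [Algebra.smul_def, mul_comm (algebraMap R Q r), ← mul_assoc] at this
        exact this
      · rintro ⟨z, hz⟩
        rw [Submodule.mem_div_iff_forall_mul_mem]
        refine ⟨fun h y hy => ?_, fun h => h x hxZ⟩
        obtain ⟨y, hy0, _, hy', rfl⟩ := Submodule.mem_sup.mp hy
        obtain ⟨r, rfl⟩ := Submodule.mem_span_singleton.mp hy'
        rw [mul_add, mul_smul_comm]
        exact add_mem (Submodule.mem_div_iff_forall_mul_mem.mp hz y hy0) (C.smul_mem r h)
    rw [relLength_add (Submodule.div_le_div_left C hZX) (Submodule.div_le_div_left C hYZ),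
      Nat.cast_add, Nat.cast_one]
    exact add_le_add (ih hZX hZ) hstep

theorem relLength_div_le {C : Submodule R Q}
    (hC : relLength C (C / IsLocalization.coeSubmodule Q (maximalIdeal R)) ≤ 1)
    {Y X : Submodule R Q} (hYX : Y ≤ X) :
    relLength (C / X) (C / Y) ≤ relLength Y X := by
  by_cases h : relLength Y X = ⊤
  · rw [h]
    exact le_top
  · obtain ⟨n, hn⟩ := ENat.ne_top_iff_exists.mp h
    rw [← hn]
    exact relLength_div_le_of_le_natCast hC n hYX hn.ge

variable [IsFractionRing R Q] [IsNoetherianRing R]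

/-- In dimension one, dualizing into a regular fractional ideal of type at most one preserves
lengths. -/
theorem IsRegularFractional.relLength_div_eq (hdim : ringKrullDim R ≤ 1) {C Y X : Submodule R Q}
    (hC : IsRegularFractional C) (hX : IsRegularFractional X) (hY : IsRegularFractional Y)
    (htype : relLength C (C / IsLocalization.coeSubmodule Q (maximalIdeal R)) ≤ 1)
    (hYX : Y ≤ X) :
    relLength (C / X) (C / Y) = relLength Y X := by
  -- For `tX ⊆ Y ⊆ X`, the length of `X / tX` and that of its dual both equal `ℓ(R / tR)`, which is
  -- finite. The inequalities for `Y ⊆ X` and `tX ⊆ Y` thus add up to an equality, so each is an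
  -- equality.
  obtain ⟨t, ht⟩ := hX.exists_smul_le hY
  have h1 := relLength_add ht hYX
  have h2 := relLength_add (Submodule.div_le_div_left C hYX) (Submodule.div_le_div_left C ht)
  have h3 : relLength (C / X) (C / (nonZeroDivisorsUnit Q t • X)) =
      Module.length R (R ⧸ Ideal.span {(t : R)}) := by
    rw [← relLength_units_smul (nonZeroDivisorsUnit Q t), div_units_smul, smul_inv_smul,
      IsRegularFractional.relLength_smul_self hdim (hC.div hX)]
  rw [IsRegularFractional.relLength_smul_self hdim hX] at h1
  have hfin := length_quotient_span_singleton_ne_top hdim t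
  have hle := relLength_div_le htype hYX
  have hle' := relLength_div_le htype ht
  rw [h3] at h2
  refine le_antisymm hle ?_
  have hfin' : relLength (nonZeroDivisorsUnit Q t • X) Y ≠ ⊤ := by
    rw [h1] at hfin
    exact fun h => hfin (by rw [h, top_add])
  refine (ENat.add_le_add_iff_left hfin').mp ?_
  rw [← h1, h2, add_comm]
  exact add_le_add_left hle' _

/-- In dimension one, regular fractional ideals are reflexive with respect to a regular fractional
ideal of type at most one. -/
theorem IsRegularFractional.div_div_eq (hdim : ringKrullDim R ≤ 1) {C X : Submodule R Q}
    (hC : IsRegularFractional C) (hX : IsRegularFractional X)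
    (htype : relLength C (C / IsLocalization.coeSubmodule Q (maximalIdeal R)) ≤ 1) :
    C / (C / X) = X := by
  refine le_antisymm ?_ (Submodule.le_div_div C X)
  -- Dualizing `X ⊆ C : (C : X)` turns its colength into that of `C : (C : (C : X)) ⊆ C : X`, which
  -- vanishes.
  rw [← relLength_eq_zero_iff, ← IsRegularFractional.relLength_div_eq hdim hC (hC.div (hC.div hX))
    hX htype (Submodule.le_div_div C X), relLength_eq_zero_iff]
  exact Submodule.le_div_div C (C / X)

end Duality

/-! ### The type as the length of `(C : 𝔪) / C`, through `Ext¹`. -/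

section CohenMacaulayType

open Abelian

variable (R : Type u) [CommRing R] [IsLocalRing R]

/-- The short exact sequence `0 → 𝔪 → R → R / 𝔪 → 0`. -/
noncomputable abbrev residueFieldSequence : ShortComplex (ModuleCat.{u} R) :=
  ShortComplex.mk (ModuleCat.ofHom (maximalIdeal R).subtype)
    (ModuleCat.ofHom (Algebra.linearMap R (ResidueField R))) (by
      ext x
      exact (residue_eq_zero_iff _).mpr x.2)

theorem residueFieldSequence_shortExact : (residueFieldSequence R).ShortExact where
  exact := by
    rw [ShortComplex.ShortExact.moduleCat_exact_iff_function_exact]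
    intro (x : R)
    refine (residue_eq_zero_iff x).trans ?_
    exact ⟨fun h => ⟨⟨x, h⟩, rfl⟩, by rintro ⟨y, rfl⟩; exact y.2⟩
  mono_f := (ModuleCat.mono_iff_injective _).mpr Subtype.val_injective
  epi_g := (ModuleCat.epi_iff_surjective _).mpr residue_surjective

variable {R} {Q : Type u} [CommRing Q] [Algebra R Q]

/-- Multiplication by an element of `C : 𝔪`, as a map from `𝔪` to `C`. -/
noncomputable def mulMaximalIdeal (C : Submodule R Q) :
    (C / IsLocalization.coeSubmodule Q (maximalIdeal R) : Submodule R Q) →ₗ[R]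
      maximalIdeal R →ₗ[R] C where
  toFun z := ((LinearMap.mulLeft R (z : Q)) ∘ₗ Algebra.linearMap R Q ∘ₗ
    (maximalIdeal R).subtype).codRestrict C fun x =>
      Submodule.mem_div_iff_forall_mul_mem.mp z.2 _ ⟨x, x.2, rfl⟩
  map_add' z w := by
    ext x
    exact add_mul _ _ _
  map_smul' r z := by
    ext x
    exact smul_mul_assoc _ _ _

@[simp] theorem coe_mulMaximalIdeal_apply (C : Submodule R Q)
    (z : (C / IsLocalization.coeSubmodule Q (maximalIdeal R) : Submodule R Q))
    (x : maximalIdeal R) : (mulMaximalIdeal C z x : Q) = z * algebraMap R Q x := rfl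

theorem mulMaximalIdeal_surjective [IsFractionRing R Q] (C : Submodule R Q)
    (h : ∃ a ∈ maximalIdeal R, a ∈ nonZeroDivisors R) :
    Function.Surjective (mulMaximalIdeal C) := by
  obtain ⟨a, ham, ha⟩ := h
  intro f
  let u := nonZeroDivisorsUnit Q ⟨a, ha⟩
  -- From `a * f x = x * f a`, the map `f` is multiplication by `f a / a`.
  have key (x : maximalIdeal R) : (f ⟨a, ham⟩ : Q) * ↑u⁻¹ * algebraMap R Q x = f x := by
    have h1 : a • f x = (x : R) • f ⟨a, ham⟩ := by
      rw [← map_smul, ← map_smul]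
      congr 1
      ext
      exact mul_comm _ _
    have h2 : (u : Q) * f x = algebraMap R Q x * f ⟨a, ham⟩ := by
      simpa [u, Algebra.smul_def] using congrArg Subtype.val h1
    rw [mul_right_comm, Units.mul_inv_eq_iff_eq_mul, mul_comm, ← h2, mul_comm]
  refine ⟨⟨(f ⟨a, ham⟩ : Q) * ↑u⁻¹, Submodule.mem_div_iff_forall_mul_mem.mpr ?_⟩, ?_⟩
  · rintro _ ⟨x, hx, rfl⟩
    rw [Algebra.linearMap_apply, key ⟨x, hx⟩]
    exact (f ⟨x, hx⟩).2
  · ext x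
    exact key x

/-- The connecting homomorphism `Hom(𝔪, M) → Ext¹(R / 𝔪, M)`. -/
noncomputable def residueFieldConnecting (M : Type u) [AddCommGroup M] [Module R M] :
    (maximalIdeal R →ₗ[R] M) →ₗ[R]
      Ext (ModuleCat.of R (ResidueField R)) (ModuleCat.of R M) 1 where
  toFun f := (residueFieldSequence_shortExact R).extClass.comp (Ext.mk₀ (ModuleCat.ofHom f))
    (add_zero 1)
  map_add' f g := by
    rw [← Ext.comp_add, ← Ext.mk₀_add]
    rfl
  map_smul' r f := by
    rw [RingHom.id_apply, ← Ext.comp_smul, ← Ext.mk₀_smul]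
    rfl

theorem residueFieldConnecting_apply {M : Type u} [AddCommGroup M] [Module R M]
    (f : maximalIdeal R →ₗ[R] M) : residueFieldConnecting M f =
      (residueFieldSequence_shortExact R).extClass.comp (Ext.mk₀ (ModuleCat.ofHom f))
        (add_zero 1) := rfl

/-- The next term of the long exact sequence is `Ext¹(R, M)`, which vanishes as `R` is projective.
-/
theorem residueFieldConnecting_surjective (M : Type u) [AddCommGroup M] [Module R M] :
    Function.Surjective (residueFieldConnecting (R := R) M) := by
  intro x
  obtain ⟨y, hy⟩ := Ext.contravariant_sequence_exact₃ (residueFieldSequence_shortExact R) _ x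
    (by
      have : Projective (residueFieldSequence R).X₂ :=
        inferInstanceAs (Projective (ModuleCat.of R R))
      exact Ext.eq_zero_of_projective _) (add_zero 1)
  obtain ⟨g, rfl⟩ := (Ext.mk₀_bijective _ _).2 y
  exact ⟨g.hom, hy⟩

theorem residueFieldConnecting_eq_zero_iff {M : Type u} [AddCommGroup M] [Module R M]
    (f : maximalIdeal R →ₗ[R] M) : residueFieldConnecting M f = 0 ↔
      ∃ y : M, ∀ x : maximalIdeal R, f x = (x : R) • y := by
  rw [residueFieldConnecting_apply]
  constructor
  · intro h
    obtain ⟨y, hy⟩ := Ext.contravariant_sequence_exact₁ (residueFieldSequence_shortExact R) _ _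
      (add_zero 1) h
    obtain ⟨g, rfl⟩ := (Ext.mk₀_bijective _ _).2 y
    rw [Ext.mk₀_comp_mk₀] at hy
    have hg := (Ext.mk₀_bijective _ _).1 hy
    refine ⟨g.hom (1 : R), fun x => ?_⟩
    have hx : g.hom (x : R) = f x := congrArg (fun k => k.hom x) hg
    rw [← hx]
    have := g.hom.map_smul (x : R) (1 : R)
    rw [← this]
    congr 1
    exact (mul_one (x : R)).symm
  · rintro ⟨y, hy⟩
    have hf : ModuleCat.ofHom f =
        (residueFieldSequence R).f ≫ ModuleCat.ofHom (LinearMap.toSpanSingleton R M y) := by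
      ext x
      exact hy x
    rw [hf, ← Ext.mk₀_comp_mk₀]
    exact ShortComplex.ShortExact.extClass_comp_assoc _ _

/-- The type of a fractional ideal `C` over a one-dimensional ring is the length of
`(C : 𝔪) / C`. -/
theorem cohenMacaulayType_one_eq_relLength [IsFractionRing R Q] (C : Submodule R Q)
    (h : ∃ a ∈ maximalIdeal R, a ∈ nonZeroDivisors R)
    {M : Type u} [AddCommGroup M] [Module R M] (e : C ≃ₗ[R] M) :
    cohenMacaulayType R 1 M =
      relLength C (C / IsLocalization.coeSubmodule Q (maximalIdeal R)) := by
  symm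
  -- The composite `C : 𝔪 → Hom(𝔪, C) → Ext¹(R / 𝔪, M)` kills `z` exactly when multiplication by `z`
  -- on `𝔪` agrees with multiplication by some `y ∈ C`. Testing on the non-zerodivisor `a` gives `z
  -- = y`.
  refine relLength_eq_length_of_surjective (residueFieldConnecting M ∘ₗ
    (LinearEquiv.congrRight e).toLinearMap ∘ₗ mulMaximalIdeal C) ?_ ?_
  · exact (residueFieldConnecting_surjective M).comp
      ((LinearEquiv.congrRight e).surjective.comp (mulMaximalIdeal_surjective C h))
  · intro z
    refine (residueFieldConnecting_eq_zero_iff _).trans ?_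
    constructor
    · rintro ⟨y, hy⟩
      obtain ⟨a, ham, ha⟩ := h
      obtain ⟨y, rfl⟩ := e.surjective y
      have h1 : e (mulMaximalIdeal C z ⟨a, ham⟩) = a • e y := hy ⟨a, ham⟩
      rw [← map_smul] at h1
      have h2 : (z : Q) * algebraMap R Q a = algebraMap R Q a * y := by
        simpa [Algebra.smul_def] using congrArg Subtype.val (e.injective h1)
      rw [mul_comm] at h2
      rw [(IsLocalization.map_units Q (⟨a, ha⟩ : nonZeroDivisors R)).mul_left_cancel h2]
      exact y.2
    · intro hz
      refine ⟨e ⟨z, hz⟩, fun x => ?_⟩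
      rw [← map_smul]
      refine congrArg e (Subtype.ext ?_)
      rw [Submodule.coe_smul, Algebra.smul_def, mul_comm]
      rfl

end CohenMacaulayType

/-! ### Counting generators over a local ring. -/

section Generators

variable {R V : Type*} [CommRing R] [IsLocalRing R] [AddCommGroup V] [Module R V]

theorem exists_finset_le_sup_span {Y X : Submodule R V} (hYX : Y ≤ X) (n : ℕ)
    (hn : relLength Y X ≤ n) :
    ∃ s : Finset V, s.card ≤ n ∧ (s : Set V) ⊆ X ∧ X ≤ Y ⊔ Submodule.span R s := by
  classical
  induction n generalizing Y with
  | zero =>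
    have h : X ≤ Y := relLength_eq_zero_iff.mp (by simpa using hn)
    exact ⟨∅, by simp, by simp, by simpa using h⟩
  | succ n ih =>
    by_cases h : X ≤ Y
    · exact ⟨∅, by simp, by simp, by simpa using h⟩
    obtain ⟨x, hxX, -, hZX, hZ⟩ := exists_relLength_sup_span_le hYX h hn
    obtain ⟨s, hs, hsX, hX⟩ := ih hZX hZ
    refine ⟨insert x s, (Finset.card_insert_le _ _).trans (by omega), ?_, ?_⟩
    · rw [Finset.coe_insert]
      exact Set.insert_subset hxX hsX
    · rwa [Finset.coe_insert, Submodule.span_insert, ← sup_assoc]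

/-- Over a local ring, a finitely generated module `X` with `X / 𝔪X` of length at most `n` is
generated by at most `n` elements. -/
theorem exists_finset_span_eq_of_relLength_le {X : Submodule R V} (hX : X.FG) {n : ℕ}
    (hn : relLength (maximalIdeal R • X) X ≤ n) :
    ∃ s : Finset V, s.card ≤ n ∧ Submodule.span R (s : Set V) = X := by
  obtain ⟨s, hs, hsX, h⟩ := exists_finset_le_sup_span Submodule.smul_le_right n hn
  refine ⟨s, hs, le_antisymm (Submodule.span_le.mpr hsX) ?_⟩
  rw [sup_comm] at h
  exact Submodule.le_of_le_smul_of_le_jacobson_bot hX (maximalIdeal_le_jacobson _) h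

theorem length_residueField : Module.length R (ResidueField R) = 1 := by
  rw [Module.length_eq_one_iff]
  exact isSimpleModule_iff_isCoatom.mpr (maximalIdeal.isMaximal R).out

/-- Over a local ring, `X / 𝔪X` has length at most the number of elements of any generating set
of `X`. -/
theorem relLength_maximalIdeal_smul_span_le (s : Finset V) :
    relLength (maximalIdeal R • Submodule.span R (s : Set V)) (Submodule.span R (s : Set V)) ≤
      s.card := by
  set X := Submodule.span R (s : Set V)
  let q := ((maximalIdeal R • X).submoduleOf X).mkQ
  let g : (s → R) →ₗ[R] X ⧸ (maximalIdeal R • X).submoduleOf X :=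
    Fintype.linearCombination R fun i : s => q ⟨i, Submodule.subset_span i.2⟩
  let h : (s → R) →ₗ[R] s → ResidueField R := (Algebra.linearMap R (ResidueField R)).compLeft s
  have hh : Function.Surjective h := fun y => by
    choose z hz using fun i => residue_surjective (y i)
    exact ⟨z, funext hz⟩
  have hg : Function.Surjective g := by
    rw [← LinearMap.range_eq_top, Fintype.range_linearCombination, eq_top_iff]
    rintro z -
    obtain ⟨⟨x, hx⟩, rfl⟩ := Submodule.mkQ_surjective _ z
    have key : ∀ x (hx : x ∈ X), q ⟨x, hx⟩ ∈ Submodule.span R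
        (Set.range fun i : s => q ⟨i, Submodule.subset_span i.2⟩) := by
      intro x hx
      induction hx using Submodule.span_induction with
      | mem x hx => exact Submodule.subset_span ⟨⟨x, hx⟩, rfl⟩
      | zero => exact zero_mem _
      | add x y hx hy hx' hy' => exact add_mem hx' hy'
      | smul r x hx hx' => exact Submodule.smul_mem _ r hx'
    exact key x hx
  -- Vectors with entries in `𝔪` die in `X / 𝔪X`, which is therefore a quotient of `k ^ s`.
  have hker : LinearMap.ker h ≤ LinearMap.ker g := by
    intro v hv
    rw [LinearMap.mem_ker, Fintype.linearCombination_apply]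
    refine Finset.sum_eq_zero fun i _ => ?_
    rw [← map_smul]
    refine (Submodule.Quotient.mk_eq_zero _).mpr ?_
    exact Submodule.smul_mem_smul ((residue_eq_zero_iff _).mp (congrFun hv i))
      (Submodule.subset_span i.2)
  calc relLength (maximalIdeal R • X) X = Module.length R ((s → R) ⧸ LinearMap.ker g) :=
        (g.quotKerEquivOfSurjective hg).length_eq.symm
    _ ≤ Module.length R ((s → R) ⧸ LinearMap.ker h) :=
        Module.length_le_of_surjective (Submodule.factor hker) (Submodule.factor_surjective hker)
    _ = Module.length R (s → ResidueField R) := (h.quotKerEquivOfSurjective hh).length_eq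
    _ = s.card := by
        rw [Module.length_pi_of_fintype]
        simp [length_residueField]

end Generators

/-- By commutativity the products are indexed by unordered pairs, repetitions allowed; hence the
binomial coefficient. -/
theorem Submodule.exists_finset_span_eq_mul_self {R A : Type*} [CommRing R] [CommRing A]
    [Algebra R A] (s : Finset A) :
    ∃ t : Finset A, t.card ≤ (s.card + 1).choose 2 ∧
      Submodule.span R (t : Set A) = Submodule.span R (s : Set A) * Submodule.span R (s : Set A) := by
  classical
  refine ⟨s.sym2.image Sym2.mul, Finset.card_image_le.trans (Finset.card_sym2 s).le, ?_⟩
  rw [Submodule.span_mul_span]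
  congr 1
  ext x
  rw [Finset.mem_coe, Finset.mem_image, Set.mem_mul]
  constructor
  · rintro ⟨p, hp, rfl⟩
    induction p with
    | h y z =>
      rw [Finset.mk_mem_sym2_iff] at hp
      exact ⟨y, hp.1, z, hp.2, rfl⟩
  · rintro ⟨y, hy, z, hz, rfl⟩
    exact ⟨s(y, z), Finset.mk_mem_sym2_iff.mpr ⟨hy, hz⟩, rfl⟩

/-! ### Finite generation, integral multipliers and reductions. -/

section FractionalIdeals

variable {R Q : Type*} [CommRing R] [CommRing Q] [Algebra R Q]

theorem coeSubmodule_mul_eq_smul (I : Ideal R) (X : Submodule R Q) :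
    IsLocalization.coeSubmodule Q I * X = I • X := by
  refine le_antisymm (Submodule.mul_le.mpr ?_) (Submodule.smul_le.mpr ?_)
  · rintro _ ⟨r, hr, rfl⟩ x hx
    rw [Algebra.linearMap_apply, ← Algebra.smul_def]
    exact Submodule.smul_mem_smul hr hx
  · intro r hr x hx
    rw [Algebra.smul_def]
    exact Submodule.mul_mem_mul ⟨r, hr, rfl⟩ hx

theorem Submodule.div_one' (C : Submodule R Q) : C / 1 = C :=
  eq_of_forall_le_iff fun X => by rw [Submodule.le_div_iff_mul_le, mul_one]

theorem IsRegularFractional.coeSubmodule {I : Ideal R} (h : ∃ s ∈ I, s ∈ R⁰) :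
    IsRegularFractional (IsLocalization.coeSubmodule Q I) := by
  obtain ⟨s, hsI, hs⟩ := h
  refine IsRegularFractional.one.of_le ?_ ⟨⟨s, hs⟩, s, hsI, rfl⟩
  rw [one_eq_coeSubmodule_top]
  exact IsLocalization.coeSubmodule_mono Q le_top

variable [IsFractionRing R Q] [IsNoetherianRing R]

theorem IsRegularFractional.fg {X : Submodule R Q} (hX : IsRegularFractional X) : X.FG := by
  obtain ⟨t, ht⟩ := hX.exists_smul_le .one
  have h1 : (1 : Submodule R Q).FG := by
    rw [Submodule.one_eq_span]
    exact Submodule.fg_span_singleton 1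
  have h2 := (h1.of_le ht).map (DistribSMul.toLinearMap R Q (nonZeroDivisorsUnit Q t)⁻¹)
  have h3 : (nonZeroDivisorsUnit Q t)⁻¹ • nonZeroDivisorsUnit Q t • X = X := inv_smul_smul _ _
  rwa [← h3]

/-- A multiplier of a regular fractional ideal is integral. -/
theorem IsRegularFractional.isIntegral_of_mul_mem {N : Submodule R Q} (hN : IsRegularFractional N)
    {q : Q} (hq : ∀ y ∈ N, q * y ∈ N) : IsIntegral R q := by
  -- `N : N` is a finitely generated module over the Noetherian ring `R`, so its submodule `R[q]` is
  -- finitely generated too.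
  have hle : Subalgebra.toSubmodule (Algebra.adjoin R {q}) ≤ N / N := by
    intro z hz
    rw [Submodule.mem_div_iff_forall_mul_mem]
    rw [Subalgebra.mem_toSubmodule] at hz
    induction hz using Algebra.adjoin_induction with
    | mem x hx =>
      rw [Set.mem_singleton_iff.mp hx]
      exact hq
    | algebraMap r =>
      intro y hy
      rw [← Algebra.smul_def]
      exact N.smul_mem r hy
    | add x y hx hy hx' hy' =>
      intro w hw
      rw [add_mul]
      exact add_mem (hx' w hw) (hy' w hw)
    | mul x y hx hy hx' hy' =>
      intro w hw
      rw [mul_assoc]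
      exact hx' _ (hy' w hw)
  exact IsIntegral.of_mem_of_fg _ ((hN.div hN).fg.of_le hle) q
    (Algebra.self_mem_adjoin_singleton R q)

/-- If `(a)` is a reduction of `I`, then `I R̄ ⊆ a R̄`. -/
theorem smul_integralClosure_le_of_isReductionOf {a : R} (ha : a ∈ R⁰) {I : Ideal R} (haI : a ∈ I)
    {n : ℕ} (hn : I ^ (n + 1) = Ideal.span {a} * I ^ n) :
    I • Subalgebra.toSubmodule (integralClosure R Q) ≤
      nonZeroDivisorsUnit Q ⟨a, ha⟩ • Subalgebra.toSubmodule (integralClosure R Q) := by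
  rw [Submodule.smul_le]
  intro r hr x hx
  rw [mem_units_smul_iff, Algebra.smul_def, ← mul_assoc]
  refine (integralClosure R Q).mul_mem ?_ hx
  -- For `r ∈ I`, the fraction `r / a` multiplies `I ^ n` into itself, as `r I ^ n ⊆ I ^ (n + 1) = a
  -- I ^ n`.
  refine IsRegularFractional.isIntegral_of_mul_mem
    (N := IsLocalization.coeSubmodule Q (I ^ n))
    (.coeSubmodule ⟨a ^ n, Ideal.pow_mem_pow haI n, pow_mem ha n⟩) ?_
  rintro _ ⟨y, hy, rfl⟩
  have h1 : r * y ∈ Ideal.span {a} * I ^ n := by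
    rw [← hn, pow_succ']
    exact Ideal.mul_mem_mul hr hy
  obtain ⟨z, hz, hz'⟩ := Ideal.mem_span_singleton_mul.mp h1
  refine ⟨z, hz, ?_⟩
  rw [Algebra.linearMap_apply, Algebra.linearMap_apply, mul_assoc, ← map_mul, ← hz', map_mul]
  exact (Units.inv_mul_cancel_left (nonZeroDivisorsUnit Q ⟨a, ha⟩) _).symm

end FractionalIdeals

/-! ### Multiplicity, the relation `C² = B`, and the two bounds. -/

section Main

/-- From exponent `n` on, `I ^ (k + 1) = a I ^ k`, and `I ^ k / a I ^ k` has the same length as `R /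
aR`. -/
theorem length_quotient_pow_succ_of_isReductionOf {R : Type*} [CommRing R] [IsNoetherianRing R]
    (hdim : ringKrullDim R ≤ 1) {I : Ideal R} {a : R} (ha : a ∈ R⁰) (haI : a ∈ I) {n : ℕ}
    (hn : I ^ (n + 1) = Ideal.span {a} * I ^ n) (j : ℕ) :
    Module.length R (R ⧸ I ^ (n + j + 1)) =
      Module.length R (R ⧸ Ideal.span {a}) + Module.length R (R ⧸ I ^ (n + j)) := by
  have hpow : I ^ (n + j + 1) = Ideal.span {a} * I ^ (n + j) := by
    rw [add_right_comm, pow_add, hn, mul_assoc, ← pow_add]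
  have hreg : IsRegularFractional (IsLocalization.coeSubmodule (FractionRing R) (I ^ (n + j))) :=
    .coeSubmodule ⟨_, Ideal.pow_mem_pow haI _, pow_mem ha _⟩
  rw [← relLength_top (I ^ (n + j + 1)), ← relLength_top (I ^ (n + j)),
    relLength_add (Ideal.pow_le_pow_right (Nat.le_succ _)) le_top,
    ← IsRegularFractional.relLength_smul_self hdim hreg ⟨a, ha⟩,
    nonZeroDivisorsUnit_smul_coeSubmodule, ← hpow, relLength_coeSubmodule]

theorem hasMultiplicity_of_isReductionOf {R : Type u} [CommRing R] [IsLocalRing R]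
    [IsNoetherianRing R] (hdim : ringKrullDim R ≤ 1) {a : R} (ha : a ∈ R⁰)
    (hred : IsReductionOf (Ideal.span {a}) (maximalIdeal R)) :
    HasMultiplicity R 1 (Module.length R (R ⧸ Ideal.span {a})).toNat := by
  obtain ⟨hle, n, hn⟩ := hred
  have ham : a ∈ maximalIdeal R := hle (Ideal.mem_span_singleton_self a)
  set e := (Module.length R (R ⧸ Ideal.span {a})).toNat
  have hfin (k : ℕ) : Module.length R (R ⧸ maximalIdeal R ^ k) ≠ ⊤ := by
    rw [← relLength_top, ← relLength_coeSubmodule (Q := FractionRing R), ← one_eq_coeSubmodule_top]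
    exact IsRegularFractional.relLength_one_ne_top hdim
      (.coeSubmodule ⟨_, Ideal.pow_mem_pow ham k, pow_mem ha k⟩)
  have hL (j : ℕ) : (Module.length R (R ⧸ maximalIdeal R ^ (n + j))).toNat =
      j * e + (Module.length R (R ⧸ maximalIdeal R ^ n)).toNat := by
    induction j with
    | zero => simp
    | succ j ih =>
      rw [← add_assoc, length_quotient_pow_succ_of_isReductionOf hdim ha ham hn,
        ENat.toNat_add (length_quotient_span_singleton_ne_top hdim ⟨a, ha⟩) (hfin _), ih]
      ring
  -- For `k = n + j` the length is `j * e + L = k * e + (L - n * e)`, where `L` is the length at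
  -- exponent `n`.
  have hlim : Tendsto (fun k : ℕ => (e : ℝ) +
      ((Module.length R (R ⧸ maximalIdeal R ^ n)).toNat - n * e : ℝ) / k) atTop (𝓝 e) := by
    simpa using (tendsto_const_div_atTop_nhds_zero_nat
      ((Module.length R (R ⧸ maximalIdeal R ^ n)).toNat - n * e : ℝ)).const_add (e : ℝ)
  refine hlim.congr' ?_
  filter_upwards [eventually_ge_atTop n, eventually_gt_atTop 0] with k hk hk0
  obtain ⟨j, rfl⟩ := Nat.exists_eq_add_of_le hk
  have hk0' : ((n + j : ℕ) : ℝ) ≠ 0 := by exact_mod_cast hk0.ne'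
  rw [hL, Nat.factorial_one, Nat.cast_one, one_mul, pow_one]
  field_simp
  push_cast
  ring

/-- A Noetherian local ring whose maximal ideal is generated by a non-zerodivisor is a discrete
valuation ring. -/
theorem exists_isDiscreteValuationRing_of_maximalIdeal_eq_span {R : Type*} [CommRing R]
    [IsLocalRing R] [IsNoetherianRing R] {a : R} (ha : a ∈ R⁰)
    (h : maximalIdeal R = Ideal.span {a}) : ∃ _ : IsDomain R, IsDiscreteValuationRing R := by
  classical
  -- By Krull's intersection theorem there is a last power `𝔪 ^ k = (a ^ k)` containing `x`; then
  -- `x` is `a ^ k` times a unit.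
  have key (x : R) (hx : x ≠ 0) : x ∈ R⁰ := by
    have hex : ∃ n, x ∉ maximalIdeal R ^ n := by
      by_contra! hall
      refine hx ?_
      rw [← Ideal.mem_bot, ← Ideal.iInf_pow_eq_bot_of_isLocalRing (maximalIdeal R)
        (maximalIdeal.isMaximal R).ne_top]
      exact Submodule.mem_iInf _ |>.mpr hall
    obtain ⟨k, hk⟩ : ∃ k, Nat.find hex = k + 1 := by
      refine Nat.exists_eq_succ_of_ne_zero fun h0 => Nat.find_spec hex ?_
      rw [h0, pow_zero, Ideal.one_eq_top]
      trivial
    have hxk : x ∈ maximalIdeal R ^ k := by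
      by_contra hc
      exact Nat.find_min hex (by omega) hc
    have hxk' := Nat.find_spec hex
    rw [hk, h, Ideal.span_singleton_pow, Ideal.mem_span_singleton] at hxk'
    rw [h, Ideal.span_singleton_pow, Ideal.mem_span_singleton] at hxk
    obtain ⟨y, rfl⟩ := hxk
    refine mul_mem (pow_mem ha k) (IsUnit.mem_nonZeroDivisors ?_)
    by_contra hy
    have hy' : y ∈ maximalIdeal R := (mem_maximalIdeal y).mpr hy
    rw [h, Ideal.mem_span_singleton] at hy'
    exact hxk' (by rw [pow_succ]; exact mul_dvd_mul_left _ hy')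
  have hnzd : NoZeroDivisors R :=
    ⟨fun {x y} hxy => or_iff_not_imp_left.mpr fun hx => (key x hx).1 y hxy⟩
  have hdom : IsDomain R := NoZeroDivisors.to_isDomain R
  refine ⟨hdom, ?_⟩
  have hfield : ¬ IsField R := by
    rw [isField_iff_maximalIdeal_eq, h, Ideal.span_singleton_eq_bot]
    exact nonZeroDivisors.ne_zero ha
  exact ((IsDiscreteValuationRing.TFAE R hfield).out 0 4 :
    IsDiscreteValuationRing R ↔ (maximalIdeal R).IsPrincipal).mpr ⟨a, h⟩

variable {R : Type u} [CommRing R]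

theorem relLength_one_inv_smul_one (Q : Type*) [CommRing Q] [Algebra R Q] [IsFractionRing R Q]
    (t : R⁰) : relLength (1 : Submodule R Q) ((nonZeroDivisorsUnit Q t)⁻¹ • 1) =
      Module.length R (R ⧸ Ideal.span {(t : R)}) := by
  rw [← relLength_nonZeroDivisorsUnit_smul_one (Q := Q),
    ← relLength_units_smul (nonZeroDivisorsUnit Q t), smul_inv_smul]

theorem one_le_one_div_coeSubmodule (Q : Type*) [CommRing Q] [Algebra R Q] (I : Ideal R) :
    (1 : Submodule R Q) ≤ 1 / IsLocalization.coeSubmodule Q I := by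
  rw [Submodule.one_le_one_div, one_eq_coeSubmodule_top]
  exact IsLocalization.coeSubmodule_mono Q le_top

/-- Multiplication by `z ∈ R : C` is a map `C → R` that takes `1 ∈ C` to `z`. -/
theorem one_div_le_coeSubmodule_traceIdeal {Q : Type*} [CommRing Q] [Algebra R Q]
    [IsFractionRing R Q] {C : Submodule R Q} (hC : 1 ≤ C) {M : Type u} [AddCommGroup M]
    [Module R M] (f : C ≃ₗ[R] M) :
    1 / C ≤ IsLocalization.coeSubmodule Q (traceIdeal R M) := by
  intro z hz
  let i : R ≃ₗ[R] (1 : Submodule R Q) :=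
    (LinearEquiv.ofInjective (Algebra.linearMap R Q) (IsFractionRing.injective R Q)).trans
      (LinearEquiv.ofEq _ _ Submodule.one_eq_range.symm)
  let m : C →ₗ[R] (1 : Submodule R Q) := (LinearMap.mulLeft R z).restrict fun x hx =>
    Submodule.mem_div_iff_forall_mul_mem.mp hz x hx
  let one : C := ⟨1, Submodule.one_le.mp hC⟩
  refine ⟨i.symm (m one), ?_, ?_⟩
  · refine Submodule.mem_iSup_of_mem (i.symm.toLinearMap ∘ₗ m ∘ₗ f.symm.toLinearMap) ⟨f one, ?_⟩
    simp
  · have h : ((i (i.symm (m one)) : (1 : Submodule R Q)) : Q) = z := by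
      rw [LinearEquiv.apply_symm_apply]
      exact mul_one z
    exact h

variable [IsLocalRing R]

theorem cohenMacaulayType_one_self_eq_relLength (Q : Type u) [CommRing Q] [Algebra R Q]
    [IsFractionRing R Q] (h : ∃ a ∈ maximalIdeal R, a ∈ nonZeroDivisors R) :
    cohenMacaulayType R 1 R =
      relLength (1 : Submodule R Q) (1 / IsLocalization.coeSubmodule Q (maximalIdeal R)) :=
  cohenMacaulayType_one_eq_relLength 1 h
    ((LinearEquiv.ofEq _ _ Submodule.one_eq_range).trans
      (LinearEquiv.ofInjective (Algebra.linearMap R Q) (IsFractionRing.injective R Q)).symm)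

theorem one_div_coeSubmodule_maximalIdeal_le (Q : Type*) [CommRing Q] [Algebra R Q]
    [IsFractionRing R Q] {a : R} (ha : a ∈ R⁰) (ham : a ∈ maximalIdeal R) :
    (1 : Submodule R Q) / IsLocalization.coeSubmodule Q (maximalIdeal R) ≤
      (nonZeroDivisorsUnit Q ⟨a, ha⟩)⁻¹ • 1 := by
  intro z hz
  rw [mem_units_smul_iff, inv_inv, mul_comm]
  exact Submodule.mem_div_iff_forall_mul_mem.mp hz _ ⟨a, ham, rfl⟩

/-- Read off from `R ⊆ R : 𝔪 ⊆ a⁻¹R`; it serves to show that the type is finite. -/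
theorem cohenMacaulayType_one_self_le {a : R} (ha : a ∈ R⁰) (ham : a ∈ maximalIdeal R) :
    cohenMacaulayType R 1 R ≤ Module.length R (R ⧸ Ideal.span {a}) := by
  rw [cohenMacaulayType_one_self_eq_relLength (FractionRing R) ⟨a, ham, ha⟩,
    ← relLength_one_inv_smul_one (FractionRing R) ⟨a, ha⟩,
    relLength_add (one_le_one_div_coeSubmodule _ _)
      (one_div_coeSubmodule_maximalIdeal_le (FractionRing R) ha ham)]
  exact le_self_add

theorem cohenMacaulayType_one_self_add_one_le [IsNoetherianRing R] {a : R} (ha : a ∈ R⁰)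
    (ham : a ∈ maximalIdeal R) (hdvr : ¬ ∃ _ : IsDomain R, IsDiscreteValuationRing R) :
    cohenMacaulayType R 1 R + 1 ≤ Module.length R (R ⧸ Ideal.span {a}) := by
  rw [cohenMacaulayType_one_self_eq_relLength (FractionRing R) ⟨a, ham, ha⟩,
    ← relLength_one_inv_smul_one (FractionRing R) ⟨a, ha⟩,
    relLength_add (one_le_one_div_coeSubmodule _ _)
      (one_div_coeSubmodule_maximalIdeal_le (FractionRing R) ha ham)]
  -- If `R : 𝔪 = a⁻¹R`, then `a⁻¹𝔪 ⊆ R`, so `𝔪 = (a)` and `R` is a discrete valuation ring.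
  refine add_le_add_right (Order.one_le_iff_ne_zero.mpr fun h0 => hdvr ?_) _
  rw [relLength_eq_zero_iff] at h0
  refine exists_isDiscreteValuationRing_of_maximalIdeal_eq_span ha (le_antisymm (fun x hx => ?_) ?_)
  · let u := nonZeroDivisorsUnit (FractionRing R) ⟨a, ha⟩
    have h1 : (↑u⁻¹ : FractionRing R) * algebraMap R (FractionRing R) x ∈
        (1 : Submodule R (FractionRing R)) := by
      refine Submodule.mem_div_iff_forall_mul_mem.mp (h0 ?_) _ ⟨x, hx, rfl⟩
      simpa using mul_mem_units_smul (u := u⁻¹)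
        (Submodule.one_le.mp (le_refl (1 : Submodule R (FractionRing R))))
    obtain ⟨y, hy⟩ := Submodule.mem_one.mp h1
    rw [Ideal.mem_span_singleton]
    refine ⟨y, IsFractionRing.injective R (FractionRing R) ?_⟩
    rw [map_mul, hy]
    exact (Units.mul_inv_cancel_left u _).symm
  · exact (Ideal.span_singleton_le_iff_mem _).mpr ham

/-- This is reflexivity of `R` itself, since `C : R = C`. -/
theorem IsRegularFractional.div_self_eq_one [IsNoetherianRing R] (hdim : ringKrullDim R ≤ 1)
    {Q : Type*} [CommRing Q] [Algebra R Q] [IsFractionRing R Q] {C : Submodule R Q}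
    (hC : IsRegularFractional C)
    (htype : relLength C (C / IsLocalization.coeSubmodule Q (maximalIdeal R)) ≤ 1) : C / C = 1 := by
  have := IsRegularFractional.div_div_eq hdim hC .one htype
  rwa [Submodule.div_one'] at this

/-- The far-flung Gorenstein property forces `C² = R̄` for a canonical fractional ideal
`R ⊆ C ⊆ R̄`. -/
theorem IsFarFlungGorenstein.mul_self_eq [IsNoetherianRing R] (hdim : ringKrullDim R ≤ 1)
    {C : Submodule R (FractionRing R)} (hC1 : 1 ≤ C)
    (hCB : C ≤ Subalgebra.toSubmodule (normalClosureRing R)) (hC : IsRegularFractional C)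
    (htype : relLength C
      (C / IsLocalization.coeSubmodule (FractionRing R) (maximalIdeal R)) ≤ 1)
    {M : Type u} [AddCommGroup M] [Module R M] (f : C ≃ₗ[R] M) (hff : IsFarFlungGorenstein R M) :
    C * C = Subalgebra.toSubmodule (normalClosureRing R) := by
  set B := Subalgebra.toSubmodule (normalClosureRing R)
  have hBB : B * B = B := Subalgebra.isIdempotentElem_toSubmodule _
  have hCCB : C * B = B := by
    refine le_antisymm ((mul_le_mul' hCB le_rfl).trans hBB.le) ?_
    simpa using mul_le_mul' hC1 (le_refl B)
  refine le_antisymm ((mul_le_mul' hCB hCB).trans hBB.le) ?_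
  have hCC := IsRegularFractional.div_self_eq_one hdim hC htype
  -- `C : C² = (C : C) : C = R : C ⊆ tr ω = R : B = (C : C) : B = C : CB = C : B`.
  have h : C / (C * C) ≤ C / B := by
    rw [← Submodule.div_div, hCC]
    refine (one_div_le_coeSubmodule_traceIdeal hC1 f).trans ?_
    rw [show IsLocalization.coeSubmodule (FractionRing R) (traceIdeal R M) = 1 / B from hff,
      ← hCC, Submodule.div_div, hCCB]
  rw [← IsRegularFractional.div_div_eq hdim hC (hC.mul hC) htype]
  exact (Submodule.le_div_div C B).trans (Submodule.div_le_div_left C h)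

/-- A canonical fractional ideal is generated by as many elements as the type of the ring. -/
theorem IsRegularFractional.exists_finset_span_eq_of_type [IsNoetherianRing R]
    (hdim : ringKrullDim R ≤ 1) {Q : Type u} [CommRing Q] [Algebra R Q] [IsFractionRing R Q]
    {C : Submodule R Q} (hC : IsRegularFractional C)
    (h : ∃ a ∈ maximalIdeal R, a ∈ nonZeroDivisors R)
    (htype : relLength C (C / IsLocalization.coeSubmodule Q (maximalIdeal R)) ≤ 1)
    {r : ℕ} (hr : cohenMacaulayType R 1 R = r) :
    ∃ s : Finset Q, s.card ≤ r ∧ Submodule.span R (s : Set Q) = C := by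
  refine exists_finset_span_eq_of_relLength_le hC.fg ?_
  have hm : IsRegularFractional (C * IsLocalization.coeSubmodule Q (maximalIdeal R)) :=
    hC.mul (.coeSubmodule h)
  -- `ℓ(C / 𝔪C) = ℓ((C : 𝔪C) / (C : C)) = ℓ((R : 𝔪) / R)`.
  rw [← hr, cohenMacaulayType_one_self_eq_relLength Q h, ← coeSubmodule_mul_eq_smul, mul_comm,
    ← IsRegularFractional.relLength_div_eq hdim hC hC hm htype, ← Submodule.div_div,
    IsRegularFractional.div_self_eq_one hdim hC htype]
  rw [mul_comm, coeSubmodule_mul_eq_smul]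
  exact Submodule.smul_le_right

end Main

theorem mainTheorem2 (R : Type u) [CommRing R] [IsLocalRing R]
    (hR : IsCohenMacaulayLocalRing R 1)
    (ω : Type u) [AddCommGroup ω] [Module R ω] (hω : IsCanonicalModule R 1 ω)
    (ha : ∃ C : Submodule R (FractionRing R),
      1 ≤ C ∧ C ≤ Subalgebra.toSubmodule (normalClosureRing R) ∧ Nonempty (C ≃ₗ[R] ω))
    (hb : Module.Finite R (normalClosureRing R))
    (hc : IsLocalRing (normalClosureRing R))
    (hd : ∃ a ∈ maximalIdeal R, a ∈ nonZeroDivisors R ∧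
      IsReductionOf (Ideal.span {a}) (maximalIdeal R))
    (hff : IsFarFlungGorenstein R ω) :
    ∃ r e : ℕ, cohenMacaulayType R 1 R = r ∧ HasMultiplicity R 1 e ∧
      ((¬ ∃ _ : IsDomain R, IsDiscreteValuationRing R) → r + 1 ≤ e) ∧
      e ≤ (r + 1).choose 2 := by
  obtain ⟨hnoeth, hdim, -⟩ := hR
  have hdim : ringKrullDim R ≤ 1 := hdim.le
  obtain ⟨C, hC1, hCB, ⟨f⟩⟩ := ha
  obtain ⟨a, ham, hreg, hred⟩ := hd
  have hBfg : (Subalgebra.toSubmodule (normalClosureRing R)).FG := Module.Finite.iff_fg.mp hb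
  have hB : IsRegularFractional (Subalgebra.toSubmodule (normalClosureRing R)) :=
    ⟨exists_mul_mem_one_of_fg hBfg, 1, by simp⟩
  have hC : IsRegularFractional C := hB.of_le hCB ⟨1, by simpa using Submodule.one_le.mp hC1⟩
  have htype : relLength C
      (C / IsLocalization.coeSubmodule (FractionRing R) (maximalIdeal R)) ≤ 1 := by
    rw [← cohenMacaulayType_one_eq_relLength C ⟨a, ham, hreg⟩ f, hω.type_eq_one]
  have hfin := length_quotient_span_singleton_ne_top hdim ⟨a, hreg⟩
  obtain ⟨e, he⟩ := ENat.ne_top_iff_exists.mp hfin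
  obtain ⟨r, hr⟩ := ENat.ne_top_iff_exists.mp
    (ne_top_of_le_ne_top hfin (cohenMacaulayType_one_self_le hreg ham))
  refine ⟨r, e, hr.symm, ?_, fun hdvr => ?_, ?_⟩
  · have := hasMultiplicity_of_isReductionOf hdim hreg hred
    rwa [← he, ENat.toNat_natCast] at this
  · have := cohenMacaulayType_one_self_add_one_le hreg ham hdvr
    rw [← hr, ← he] at this
    exact_mod_cast this
  · obtain ⟨s, hs, rfl⟩ := IsRegularFractional.exists_finset_span_eq_of_type hdim hC
      ⟨a, ham, hreg⟩ htype hr.symm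
    obtain ⟨t, ht, hts⟩ := Submodule.exists_finset_span_eq_mul_self (R := R) s
    rw [IsFarFlungGorenstein.mul_self_eq hdim hC1 hCB hC htype f hff] at hts
    obtain ⟨-, n, hn⟩ := hred
    have h1 := relLength_maximalIdeal_smul_span_le (R := R) t
    rw [hts] at h1
    -- `𝔪B ⊆ aB` gives `ℓ(B / aB) ≤ ℓ(B / 𝔪B) ≤ t.card`, and `ℓ(B / aB) = ℓ(R / aR) = e`.
    have h2 := (relLength_le_of_le (smul_integralClosure_le_of_isReductionOf hreg ham hn)).trans h1
    rw [IsRegularFractional.relLength_smul_self hdim hB, ← he] at h2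
    exact (Nat.cast_le.mp h2).trans (ht.trans (Nat.choose_le_choose 2 (by omega)))
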